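/- For a finite simple graph $G=(V,E)$ with $n=|V|$ and $S\subseteq V$, let $\Gamma^-(S)$ be the set of vertices outside $S$ that have a neighbour in $S$, and for $S'\subseteq S$ let $\Gamma^1_S(S')$ be the set of vertices outside $S$ that have exactly one neighbour in $S'$. For $\alpha,\beta>0$, $G$ is an $(\alpha,\beta)$-expander if $|\Gamma^-(S)|\ge\beta|S|$ for every $S\subseteq V$ with $|S|\le\alpha n$. For $\alpha n\ge 1$, the wireless expansion of $G$ (with respect to $\alpha$) is $$\beta_w(G)=\min\Bigl\{\max_{S'\subseteq S}\frac{|\Gamma^1_S(S')|}{|S|} \;:\; \emptyset\ne S\subseteq V,\ |S|\le\alpha n\Bigr\}.$$ Theorem. There are absolute constants $C,c>0$ such that the following hold. (1) For every integer $\Delta\ge1$ and every real $\beta$ with $1/\Delta\le\beta\le\Delta$ there exist $\alpha>0$ and an $(\alpha,\beta)$-expander $G$ with maximum degree exactly $\Delta$, on $n\geq 1/\alpha$ vertices, whose wireless expansion with respect to $\alpha$ satisfies $$\beta_w(G)\le C\cdot\frac{\beta}{\log_2\bigl(2\min\{\Delta/\beta,\ \Delta\beta\}\bigr)}.$$ (2)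 Moreover, for every integer $\Delta\ge1$, every real $\beta$ with $1/\Delta\le\beta\le c\Delta$ and every $\alpha$ with $0<\alpha\le c/(1+\beta)$, there is an integer $n_0\ge 1/\alpha$ such that for every $n\ge n_0$ there is an $n$-vertex $(\alpha,\beta)$-expander $G$ with maximum degree exactly $\Delta$ whose wireless expansion with respect to $\alpha$ satisfies the same bound, with the same constant $C$. -/

import Mathlib

namespace WirelessExpander

variable {V : Type*} [Fintype V]

open Classical in
/-- `Γ⁻(S)`: the vertices outside `S` with at least one neighbour in `S`. -/
noncomputable def extNbhd (G : SimpleGraph V) (S : Finset V) : Finset V :=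
  Finset.univ.filter fun v => v ∉ S ∧ ∃ u ∈ S, G.Adj u v

open Classical in
/-- `Γ¹_S(S')`, the `S`-excluding unique-neighbourhood of `S'`: the vertices outside `S`
with exactly one neighbour in `S'`. -/
noncomputable def uniqueNbhd (G : SimpleGraph V) (S S' : Finset V) : Finset V :=
  Finset.univ.filter fun v => v ∉ S ∧ ∃! u, u ∈ S' ∧ G.Adj u v

/-- `G` is an `(α, β)` vertex expander, for positive parameters `α` and `β`: every set `S` of at
most `α |V|` vertices has at least `β |S|` external neighbours. -/
def IsExpander (G : SimpleGraph V) (α β : ℝ) : Prop :=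
  0 < α ∧ 0 < β ∧
    ∀ S : Finset V, (S.card : ℝ) ≤ α * Fintype.card V →
      β * (S.card : ℝ) ≤ ((extNbhd G S).card : ℝ)

/-- The wireless expansion of a vertex set `S`: the maximum of `|Γ¹_S(S')| / |S|` over all
subsets `S'` of `S`. -/
noncomputable def setWirelessExpansion (G : SimpleGraph V) (S : Finset V) : ℝ :=
  S.powerset.sup' S.powerset_nonempty
    fun S' => ((uniqueNbhd G S S').card : ℝ) / (S.card : ℝ)

/-- The wireless expansion of the graph `G` at the size parameter `α`: the minimum wireless
expansion over all nonempty vertex sets `S` with `|S| ≤ α |V|`. (There are finitely many such sets;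
there is at least one as soon as `1 ≤ α |V|`.) -/
noncomputable def wirelessExpansion (G : SimpleGraph V) (α : ℝ) : ℝ :=
  sInf {r : ℝ | ∃ S : Finset V, S.Nonempty ∧ (S.card : ℝ) ≤ α * Fintype.card V ∧
    r = setWirelessExpansion G S}

end WirelessExpander

/-! The obstruction is a dyadic gadget. Its points are the leaves `x` of a binary tree of height
`k`, each in `p` copies; its other side consists, for each height `j ≤ k`, of the positions `y`,
each in `q` copies, and `x` sees `(j, y)` when both lie in the same block of height `j`. A point `x`
sees the positions `y = x` at all heights, so sets of points expand by at least `(k+1)q/p`. But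
every subset has at most `q * 2^(k+1)` unique neighbours: if a block contains exactly one chosen
point, one of its halves is empty and contributes nothing below, while otherwise the block itself
contributes nothing. Hence the wireless expansion of the point set is at most `2q/p`, smaller by a
factor of order `k`, and the parameters make `k` of order `log (2 min(Δ/β, Δβ))`.

To expand every small set, the non-point side is embedded in the vertex set of a graph that expands
by `2β + 1`, given by a union bound over tuples of permutations. In a mixed set either the points or
the rest provide enough neighbours. Edges avoiding the points are then added until the maximum
degree is exactly `Δ`; this preserves expansion and leaves the unique neighbourhoods of the gadget
unchanged.

When `β` is within a constant factor of `Δ`, the logarithm is bounded and the complete graph on `Δ +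
1` vertices suffices. -/

namespace WirelessExpander

open Finset

/-! ### Probability that a random permutation maps one set into another -/

section PermCount

variable {V : Type*} [Fintype V] [DecidableEq V]

theorem exists_perm_image_eq {X X' : Finset V} (h : X.card = X'.card) :
    ∃ τ : Equiv.Perm V, X.image τ = X' := by
  let e : {v // v ∈ X} ≃ {v // v ∈ X'} := Finset.equivOfCardEq h
  refine ⟨e.extendSubtype, Finset.eq_of_subset_of_card_le ?_ ?_⟩
  · intro w hw
    obtain ⟨v, hv, rfl⟩ := Finset.mem_image.1 hw
    exact e.extendSubtype_mem v hv
  · rw [Finset.card_image_of_injective _ (Equiv.injective _), h]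

theorem card_perm_image_subset_congr {X X' : Finset V} (h : X.card = X'.card) (Y : Finset V) :
    (univ.filter fun σ : Equiv.Perm V => X.image σ ⊆ Y).card =
      (univ.filter fun σ : Equiv.Perm V => X'.image σ ⊆ Y).card := by
  obtain ⟨τ, rfl⟩ := exists_perm_image_eq h
  refine Finset.card_bij' (fun σ _ => σ * τ⁻¹) (fun σ _ => σ * τ) ?_ ?_ ?_ ?_ <;>
    simp [Finset.image_image, Finset.subset_iff]

/-- The number of permutations mapping `X` into `Y`. -/
theorem card_perm_image_subset_mul_choose (X Y : Finset V) :
    (univ.filter fun σ : Equiv.Perm V => X.image σ ⊆ Y).card *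
        (Fintype.card V).choose X.card =
      (Fintype.card V).factorial * Y.card.choose X.card := by
  have hcount : ∀ σ : Equiv.Perm V,
      ((univ.powersetCard X.card).filter fun X' : Finset V => X'.image σ ⊆ Y).card =
        Y.card.choose X.card := by
    intro σ
    rw [← Finset.card_powersetCard]
    refine Finset.card_bij' (fun A _ => A.image σ) (fun A _ => A.image σ.symm) ?_ ?_ ?_ ?_
    · intro A hA
      simp only [mem_filter, mem_powersetCard] at hA
      rw [mem_powersetCard, Finset.card_image_of_injective _ σ.injective]
      exact ⟨hA.2, hA.1.2⟩
    · intro A hA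
      rw [mem_powersetCard] at hA
      simp only [mem_filter, mem_powersetCard, subset_univ, true_and]
      rw [Finset.card_image_of_injective _ σ.symm.injective]
      refine ⟨hA.2, ?_⟩
      simpa [Finset.image_image] using hA.1
    · intro A _; simp [Finset.image_image]
    · intro A _; simp [Finset.image_image]
  -- Double count the pairs `(X', σ)` with `σ X' ⊆ Y`: by symmetry all `X'` of size `|X|` contribute
  -- equally, and by `hcount` so do all `σ`.
  have := Finset.sum_card_bipartiteAbove_eq_sum_card_bipartiteBelow
    (s := (univ.powersetCard X.card : Finset (Finset V))) (t := (univ : Finset (Equiv.Perm V)))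
    (fun X' σ => X'.image σ ⊆ Y)
  simp only [Finset.bipartiteAbove, Finset.bipartiteBelow, hcount] at this
  rw [Finset.sum_congr rfl (g := fun _ => (univ.filter fun σ : Equiv.Perm V => X.image σ ⊆ Y).card)
    (fun X' hX' => (card_perm_image_subset_congr (mem_powersetCard.1 hX').2.symm Y).symm)] at this
  simpa [Fintype.card_perm, mul_comm] using this

theorem descFactorial_mul_pow_le {y m : ℕ} (h : y ≤ m) (x : ℕ) :
    y.descFactorial x * m ^ x ≤ m.descFactorial x * y ^ x := by
  induction x with
  | zero => simp
  | succ x ih =>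
    have h1 : (y - x) * m ≤ (m - x) * y := by
      rw [Nat.sub_mul, Nat.sub_mul, mul_comm m y]
      exact Nat.sub_le_sub_left (Nat.mul_le_mul_left x h) _
    calc y.descFactorial (x + 1) * m ^ (x + 1)
        = ((y - x) * m) * (y.descFactorial x * m ^ x) := by
          rw [Nat.descFactorial_succ, pow_succ]; ring
      _ ≤ ((m - x) * y) * (m.descFactorial x * y ^ x) := Nat.mul_le_mul h1 ih
      _ = m.descFactorial (x + 1) * y ^ (x + 1) := by
          rw [Nat.descFactorial_succ, pow_succ]; ring

theorem choose_mul_pow_le {y m : ℕ} (h : y ≤ m) (x : ℕ) :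
    y.choose x * m ^ x ≤ m.choose x * y ^ x := by
  have := descFactorial_mul_pow_le h x
  rw [Nat.descFactorial_eq_factorial_mul_choose, Nat.descFactorial_eq_factorial_mul_choose,
    mul_assoc, mul_assoc] at this
  exact Nat.le_of_mul_le_mul_left this x.factorial_pos

/-- Sampling without replacement is no likelier to stay inside `Y` than sampling with replacement.
-/
theorem card_perm_image_subset_le {X Y : Finset V} (hX : X.Nonempty) :
    ((univ.filter fun σ : Equiv.Perm V => X.image σ ⊆ Y).card : ℝ) ≤
      (Fintype.card V).factorial * ((Y.card : ℝ) / Fintype.card V) ^ X.card := by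
  set m := Fintype.card V with hm
  have hXm : X.card ≤ m := Finset.card_le_univ X
  have hm0 : (0 : ℝ) < m := by
    have := hX.card_pos
    exact_mod_cast this.trans_le hXm
  have h1 := card_perm_image_subset_mul_choose X Y
  have h2 := choose_mul_pow_le (Finset.card_le_univ Y) X.card
  rw [← hm] at h1 h2
  have hc : (0 : ℝ) < m.choose X.card := by exact_mod_cast Nat.choose_pos hXm
  rw [div_pow, ← mul_div_assoc, le_div_iff₀ (by positivity)]
  refine le_of_mul_le_mul_right ?_ hc
  have h1' : ((univ.filter fun σ : Equiv.Perm V => X.image σ ⊆ Y).card : ℝ) * m.choose X.card =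
    m.factorial * Y.card.choose X.card := by exact_mod_cast h1
  have h2' : (Y.card.choose X.card : ℝ) * m ^ X.card ≤ m.choose X.card * Y.card ^ X.card := by
    exact_mod_cast h2
  calc _ = ((univ.filter fun σ : Equiv.Perm V => X.image σ ⊆ Y).card : ℝ) * m.choose X.card
          * (m : ℝ) ^ X.card := by ring
    _ = m.factorial * (Y.card.choose X.card * (m : ℝ) ^ X.card) := by rw [h1']; ring
    _ ≤ m.factorial * (m.choose X.card * Y.card ^ X.card) := by gcongr
    _ = _ := by ring

end PermCount

/-! ### Union bound and expanding graphs from permutations -/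

theorem choose_le_exp_mul_div_pow (m : ℕ) {r : ℕ} (hr : 0 < r) :
    (m.choose r : ℝ) ≤ (Real.exp 1 * m / r) ^ r := by
  have hr' : (0 : ℝ) < r := by exact_mod_cast hr
  have h1 : (m.choose r : ℝ) ≤ (m : ℝ) ^ r / r.factorial := Nat.choose_le_pow_div r m
  have h2 : (r : ℝ) ^ r / r.factorial ≤ Real.exp r := Real.pow_div_factorial_le_exp _ hr'.le r
  have hf : (0 : ℝ) < r.factorial := by exact_mod_cast r.factorial_pos
  calc (m.choose r : ℝ) ≤ (m : ℝ) ^ r / r.factorial := h1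
    _ = ((r : ℝ) ^ r / r.factorial) * ((m : ℝ) ^ r / (r : ℝ) ^ r) := by field_simp
    _ ≤ Real.exp r * ((m : ℝ) ^ r / (r : ℝ) ^ r) := by gcongr
    _ = (Real.exp 1 * m / r) ^ r := by
      rw [div_pow, mul_pow, ← Real.exp_nat_mul, mul_one, mul_div_assoc]

/-- The union-bound term for sets of size `x`. With `z = (h+1)x/m`, the binomials cost about
`z^(-(h+2))` per element of `X`. Of the `2(h+2)` permutations, half cancel this cost and the other
half supply the decay. -/
theorem choose_mul_choose_mul_pow_le {m x h : ℕ} (hx : 0 < x)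
    (hm : 24 * ((h + 1) * x) ≤ m) :
    (m.choose x : ℝ) * m.choose ((h + 1) * x) *
      ((((h + 1) * x : ℕ) : ℝ) / m) ^ (x * (2 * (h + 2))) ≤ (1 / 4) ^ x := by
  have hx' : (0 : ℝ) < x := by exact_mod_cast hx
  have hy0 : 0 < (h + 1) * x := by positivity
  have hm0 : (0 : ℝ) < m := by exact_mod_cast (by omega : 0 < m)
  have hmr : (24 : ℝ) * (((h + 1) * x : ℕ) : ℝ) ≤ m := by exact_mod_cast hm
  set z : ℝ := (((h + 1) * x : ℕ) : ℝ) / m with hz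
  have hzp : 0 < z := div_pos (by exact_mod_cast hy0) hm0
  have hz1 : z ≤ 1 / 24 := by
    rw [hz, div_le_iff₀ hm0]; linarith
  have he : Real.exp 1 < 3 := Real.exp_one_lt_three
  have he0 := Real.exp_pos 1
  have h1 : (m.choose x : ℝ) ≤ ((h + 1) * (Real.exp 1 / z)) ^ x := by
    refine (choose_le_exp_mul_div_pow m hx).trans_eq ?_
    congr 1; rw [hz]; push_cast; field_simp
  have h2 : (m.choose ((h + 1) * x) : ℝ) ≤ ((Real.exp 1 / z) ^ (h + 1)) ^ x := by
    refine (choose_le_exp_mul_div_pow m hy0).trans_eq ?_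
    rw [pow_mul]; congr 2; rw [hz]; field_simp
  have h3 : ((h : ℝ) + 1) ≤ 2 ^ (h + 2) := by
    have : h + 2 < 2 ^ (h + 2) := Nat.lt_two_pow_self
    have : h + 1 ≤ 2 ^ (h + 2) := by omega
    exact_mod_cast this
  calc (m.choose x : ℝ) * m.choose ((h + 1) * x) * z ^ (x * (2 * (h + 2)))
      ≤ ((h + 1) * (Real.exp 1 / z)) ^ x * ((Real.exp 1 / z) ^ (h + 1)) ^ x *
          z ^ (x * (2 * (h + 2))) := by gcongr
    _ = (((h : ℝ) + 1) * (Real.exp 1 / z) ^ (h + 2) * (z ^ (h + 2) * z ^ (h + 2))) ^ x := by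
        rw [mul_comm x, pow_mul, ← mul_pow, ← mul_pow, ← pow_add]
        congr 1
        rw [pow_succ (Real.exp 1 / z) (h + 1), two_mul]; ring
    _ = (((h : ℝ) + 1) * (Real.exp 1 * z) ^ (h + 2)) ^ x := by
        congr 1
        rw [div_pow, mul_pow]; field_simp
    _ ≤ (2 ^ (h + 2) * (Real.exp 1 * z) ^ (h + 2)) ^ x := by gcongr
    _ = ((2 * (Real.exp 1 * z)) ^ (h + 2)) ^ x := by rw [mul_pow 2]
    _ ≤ (1 / 4) ^ x := by
        -- The constant `24` is chosen for this: `e < 3` and `z ≤ 1/24`.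
        have hb : 2 * (Real.exp 1 * z) ≤ 1 / 4 := by nlinarith
        have hb0 : 0 ≤ 2 * (Real.exp 1 * z) := by positivity
        gcongr
        calc (2 * (Real.exp 1 * z)) ^ (h + 2) ≤ (2 * (Real.exp 1 * z)) ^ 1 :=
              pow_le_pow_of_le_one hb0 (by linarith) (by omega)
          _ ≤ 1 / 4 := by rwa [pow_one]

theorem sum_Icc_quarter_pow_lt_one (K : ℕ) : ∑ x ∈ Icc 1 K, ((1 : ℝ) / 4) ^ x < 1 := by
  have : ∑ x ∈ Icc 1 K, ((1 : ℝ) / 4) ^ x ≤ (1 - (1 / 4) ^ K) / 3 := by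
    induction K with
    | zero => simp
    | succ K ih =>
      rw [Finset.sum_Icc_succ_top (by omega), pow_succ]
      linarith
  have h : (0 : ℝ) ≤ (1 / 4) ^ K := by positivity
  linarith

/-- A family of `2 (h + 2)` permutations under which the images of every small set `X` do not all
fit into a set of size `(h + 1) |X|`. -/
theorem exists_perms_expanding (V : Type*) [Fintype V] [DecidableEq V] (h : ℕ) :
    ∃ σ : Fin (2 * (h + 2)) → Equiv.Perm V, ∀ X Y : Finset V, X.Nonempty →
      24 * ((h + 1) * X.card) ≤ Fintype.card V → Y.card = (h + 1) * X.card →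
      ∃ i, ¬ X.image (σ i) ⊆ Y := by
  classical
  set m := Fintype.card V with hm
  set d := 2 * (h + 2) with hd
  let K := m / (24 * (h + 1))
  have hK : ∀ x, x ≤ K ↔ 24 * ((h + 1) * x) ≤ m := by
    intro x
    rw [Nat.le_div_iff_mul_le (by positivity)]
    constructor <;> intro h <;> linarith
  let bad (X Y : Finset V) : Finset (Fin d → Equiv.Perm V) :=
    Fintype.piFinset fun _ => univ.filter fun σ : Equiv.Perm V => X.image σ ⊆ Y
  -- The tuples that fail for some pair `(X, Y)`; fewer than all `(m!)^d` tuples.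
  let B : Finset (Fin d → Equiv.Perm V) :=
    (Icc 1 K).biUnion fun x => (univ.powersetCard x).biUnion fun X =>
      (univ.powersetCard ((h + 1) * x)).biUnion fun Y => bad X Y
  have hbad : ∀ x ∈ Icc 1 K, ∀ X ∈ (univ : Finset V).powersetCard x,
      ∀ Y ∈ (univ : Finset V).powersetCard ((h + 1) * x),
      ((bad X Y).card : ℝ) ≤
        (m.factorial : ℝ) ^ d * ((((h + 1) * x : ℕ) : ℝ) / m) ^ (x * d) := by
    intro x hx X hX Y hY
    rw [mem_powersetCard] at hX hY
    rw [mem_Icc] at hx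
    rw [Fintype.card_piFinset_const, pow_mul _ x d, ← mul_pow]
    push_cast
    gcongr
    have := card_perm_image_subset_le (X := X) (Y := Y)
      (Finset.card_pos.1 (by omega))
    rw [hX.2, hY.2] at this
    exact_mod_cast this
  have hB : (B.card : ℝ) < (m.factorial : ℝ) ^ d := by
    have hpos : (0 : ℝ) < (m.factorial : ℝ) ^ d := by
      have := m.factorial_pos
      positivity
    calc (B.card : ℝ) ≤ ∑ x ∈ Icc 1 K, ∑ X ∈ (univ : Finset V).powersetCard x,
          ∑ Y ∈ (univ : Finset V).powersetCard ((h + 1) * x), ((bad X Y).card : ℝ) := by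
          have : B.card ≤ ∑ x ∈ Icc 1 K, ∑ X ∈ (univ : Finset V).powersetCard x,
              ∑ Y ∈ (univ : Finset V).powersetCard ((h + 1) * x), (bad X Y).card :=
            card_biUnion_le.trans (Finset.sum_le_sum fun x _ =>
              card_biUnion_le.trans (Finset.sum_le_sum fun X _ => card_biUnion_le))
          exact_mod_cast this
      _ ≤ ∑ x ∈ Icc 1 K, ∑ X ∈ (univ : Finset V).powersetCard x,
          ∑ Y ∈ (univ : Finset V).powersetCard ((h + 1) * x),
            (m.factorial : ℝ) ^ d * ((((h + 1) * x : ℕ) : ℝ) / m) ^ (x * d) :=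
          Finset.sum_le_sum fun x hx => Finset.sum_le_sum fun X hX =>
            Finset.sum_le_sum fun Y hY => hbad x hx X hX Y hY
      _ = ∑ x ∈ Icc 1 K, (m.factorial : ℝ) ^ d * ((m.choose x : ℝ) * m.choose ((h + 1) * x) *
            ((((h + 1) * x : ℕ) : ℝ) / m) ^ (x * d)) := by
          refine Finset.sum_congr rfl fun x _ => ?_
          simp only [sum_const, card_powersetCard, card_univ, nsmul_eq_mul, ← hm]
          ring
      _ ≤ ∑ x ∈ Icc 1 K, (m.factorial : ℝ) ^ d * (1 / 4) ^ x := by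
          refine Finset.sum_le_sum fun x hx => ?_
          rw [mem_Icc] at hx
          gcongr
          exact choose_mul_choose_mul_pow_le (by omega) ((hK x).1 hx.2)
      _ = (m.factorial : ℝ) ^ d * ∑ x ∈ Icc 1 K, ((1 : ℝ) / 4) ^ x := by rw [Finset.mul_sum]
      _ < (m.factorial : ℝ) ^ d := by
          have := sum_Icc_quarter_pow_lt_one K
          nlinarith
  have hcard : B.card < (univ : Finset (Fin d → Equiv.Perm V)).card := by
    have h1 : (univ : Finset (Fin d → Equiv.Perm V)).card = m.factorial ^ d := by
      simp [Fintype.card_perm, hm]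
    rw [h1]; exact_mod_cast hB
  obtain ⟨σ, -, hσ⟩ := Finset.exists_mem_notMem_of_card_lt_card hcard
  refine ⟨σ, fun X Y hX hXm hY => ?_⟩
  by_contra! hcon
  refine hσ ?_
  simp only [B, mem_biUnion]
  exact ⟨X.card, mem_Icc.2 ⟨hX.card_pos, (hK _).2 hXm⟩, X, mem_powersetCard.2 ⟨subset_univ _, rfl⟩,
    Y, mem_powersetCard.2 ⟨subset_univ _, hY⟩, by simpa [bad] using hcon⟩

/-- The graph whose edges join each vertex to its images under a family of permutations. -/
def permGraph {V ι : Type*} (σ : ι → Equiv.Perm V) : SimpleGraph V :=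
  SimpleGraph.fromRel fun u v => ∃ i, σ i u = v

theorem card_filter_permGraph_adj_le {V ι : Type*} [Fintype V] [Fintype ι]
    (σ : ι → Equiv.Perm V) (v : V) [DecidablePred ((permGraph σ).Adj v)] :
    (univ.filter fun w => (permGraph σ).Adj v w).card ≤ 2 * Fintype.card ι := by
  classical
  have hsub : (univ.filter fun w => (permGraph σ).Adj v w) ⊆
      univ.image (fun i => σ i v) ∪ univ.image (fun i => (σ i).symm v) := by
    intro w hw
    simp only [permGraph, mem_filter, mem_univ, true_and, SimpleGraph.fromRel_adj] at hw
    simp only [mem_union, mem_image, mem_univ, true_and]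
    rcases hw.2 with ⟨i, hi⟩ | ⟨i, hi⟩
    · exact Or.inl ⟨i, hi⟩
    · exact Or.inr ⟨i, by rw [← hi]; simp⟩
  refine (card_le_card hsub).trans ((card_union_le _ _).trans ?_)
  rw [two_mul]
  exact add_le_add (card_image_le.trans_eq card_univ) (card_image_le.trans_eq card_univ)

/-- Graphs of maximum degree at most `4 (h + 2)` in which all sets of size up to a constant
fraction of `|V| / (h + 1)` expand by a factor `h`. -/
theorem exists_expanding_graph (V : Type*) [Fintype V] (h : ℕ) :
    ∃ H : SimpleGraph V,
      (∀ (v : V) [DecidablePred (H.Adj v)],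
        (univ.filter fun w => H.Adj v w).card ≤ 4 * (h + 2)) ∧
      ∀ X : Finset V, 24 * ((h + 1) * X.card) ≤ Fintype.card V →
        h * X.card ≤ (extNbhd H X).card := by
  classical
  obtain ⟨σ, hσ⟩ := exists_perms_expanding V h
  refine ⟨permGraph σ, fun v _ => ?_, fun X hX => ?_⟩
  · refine (card_filter_permGraph_adj_le σ v).trans ?_
    rw [Fintype.card_fin]; omega
  · rcases X.eq_empty_or_nonempty with rfl | hne
    · simp
    by_contra! hlt
    -- This union contains every image `σ i X`; padded to size exactly `(h + 1)|X|`, it would trap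
    -- them all.
    have hcard : (X ∪ extNbhd (permGraph σ) X).card ≤ (h + 1) * X.card := by
      refine (card_union_le _ _).trans ?_
      rw [add_mul]; omega
    obtain ⟨Y, hY, hYc⟩ := Finset.exists_superset_card_eq hcard (by omega)
    obtain ⟨i, hi⟩ := hσ X Y hne hX hYc
    refine hi fun w hw => hY ?_
    obtain ⟨v, hv, rfl⟩ := mem_image.1 hw
    rw [mem_union]
    by_cases hwX : σ i v ∈ X
    · exact Or.inl hwX
    · refine Or.inr ?_
      simp only [extNbhd, mem_filter, mem_univ, true_and]
      refine ⟨hwX, v, hv, ?_⟩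
      rw [permGraph, SimpleGraph.fromRel_adj]
      exact ⟨fun he => hwX (he ▸ hv), Or.inl ⟨i, rfl⟩⟩

/-! ### The dyadic gadget: large neighbourhoods, few unique neighbours -/

section DyadicGadget

open Classical in
/-- The positions `y` in the `c`-th dyadic block of height `k` whose height-`j` block contains
exactly one point of the family `f` over `A`. -/
theorem sum_card_existsUnique_dyadic_le {ι : Type*} (A : Set ι) (f : ι → ℕ) (k : ℕ) : ∀ c : ℕ,
    ∑ j ∈ range (k + 1), ((Ico (c * 2 ^ k) ((c + 1) * 2 ^ k)).filter
      fun y => ∃! s, s ∈ A ∧ f s / 2 ^ j = y / 2 ^ j).card ≤ 2 ^ (k + 1) := by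
  have hdecomp : ∀ (k c j : ℕ), ((Ico (c * 2 ^ (k + 1)) ((c + 1) * 2 ^ (k + 1))).filter
      fun y => ∃! s, s ∈ A ∧ f s / 2 ^ j = y / 2 ^ j).card =
      ((Ico ((2 * c) * 2 ^ k) ((2 * c + 1) * 2 ^ k)).filter
        fun y => ∃! s, s ∈ A ∧ f s / 2 ^ j = y / 2 ^ j).card +
      ((Ico ((2 * c + 1) * 2 ^ k) ((2 * c + 1 + 1) * 2 ^ k)).filter
        fun y => ∃! s, s ∈ A ∧ f s / 2 ^ j = y / 2 ^ j).card := by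
    intro k c j
    rw [← card_union_of_disjoint, ← filter_union, Ico_union_Ico_eq_Ico]
    · congr 3 <;> ring
    · gcongr; omega
    · gcongr; omega
    · exact Finset.disjoint_filter_filter (Finset.Ico_disjoint_Ico_consecutive _ _ _)
  -- A block without points contributes nothing at any height up to its own, since the smaller
  -- blocks are nested in it.
  have hzero : ∀ k c, (∀ s ∈ A, f s / 2 ^ k ≠ c) →
      ∑ j ∈ range (k + 1), ((Ico (c * 2 ^ k) ((c + 1) * 2 ^ k)).filter
        fun y => ∃! s, s ∈ A ∧ f s / 2 ^ j = y / 2 ^ j).card = 0 := by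
    intro k c hc
    refine Finset.sum_eq_zero fun j hj => ?_
    rw [card_eq_zero, filter_eq_empty_iff]
    rintro y hy ⟨s, ⟨hs, hsy⟩, -⟩
    rw [mem_Ico] at hy
    rw [mem_range] at hj
    refine hc s hs ?_
    have hk : 2 ^ k = 2 ^ j * 2 ^ (k - j) := by rw [← pow_add]; congr 1; omega
    have : y / 2 ^ k = c := by
      rw [Nat.div_eq_iff (by positivity)]
      have : 0 < 2 ^ k := by positivity
      constructor
      · linarith
      · rw [add_mul] at hy; omega
    rw [← this, hk, ← Nat.div_div_eq_div_mul, ← Nat.div_div_eq_div_mul, hsy]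
  induction k with
  | zero =>
    intro c
    simp only [zero_add, range_one, sum_singleton]
    refine (card_filter_le _ _).trans ?_
    simp
  | succ k ih =>
    intro c
    rw [Finset.sum_range_succ]
    simp_rw [hdecomp k c]
    rw [Finset.sum_add_distrib, ← hdecomp k c]
    have hl := ih (2 * c)
    have hr := ih (2 * c + 1)
    have hp : 2 ^ (k + 1 + 1) = 2 ^ (k + 1) + 2 ^ (k + 1) := by ring
    -- If the whole block has a unique point, the top height costs at most `2^(k+1)`, but the half
    -- without that point contributes zero. Otherwise the top height contributes zero. Either way
    -- two terms of size `2^(k+1)` remain.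
    by_cases htop : ∃! s, s ∈ A ∧ f s / 2 ^ (k + 1) = c
    · have htopcard : ((Ico (c * 2 ^ (k + 1)) ((c + 1) * 2 ^ (k + 1))).filter
          fun y => ∃! s, s ∈ A ∧ f s / 2 ^ (k + 1) = y / 2 ^ (k + 1)).card ≤ 2 ^ (k + 1) := by
        refine (card_filter_le _ _).trans ?_
        rw [Nat.card_Ico, add_mul]; omega
      obtain ⟨s, ⟨hs, hsc⟩, huniq⟩ := htop
      have hhalf : ∀ t, f t / 2 ^ (k + 1) = f t / 2 ^ k / 2 := fun t => by
        rw [pow_succ, Nat.div_div_eq_div_mul]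
      have hor : f s / 2 ^ k = 2 * c ∨ f s / 2 ^ k = 2 * c + 1 := by
        rw [hhalf] at hsc; omega
      rcases hor with h0 | h1
      · have := hzero k (2 * c + 1) (fun t ht htc => by
          have : t = s := huniq t ⟨ht, by rw [hhalf, htc]; omega⟩
          subst this; omega)
        omega
      · have := hzero k (2 * c) (fun t ht htc => by
          have : t = s := huniq t ⟨ht, by rw [hhalf, htc]; omega⟩
          subst this; omega)
        omega
    · have htopcard : ((Ico (c * 2 ^ (k + 1)) ((c + 1) * 2 ^ (k + 1))).filter
          fun y => ∃! s, s ∈ A ∧ f s / 2 ^ (k + 1) = y / 2 ^ (k + 1)).card = 0 := by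
        rw [card_eq_zero, filter_eq_empty_iff]
        intro y hy
        rw [mem_Ico] at hy
        have : y / 2 ^ (k + 1) = c := by
          rw [Nat.div_eq_iff (by positivity)]
          have : 0 < 2 ^ (k + 1) := by positivity
          constructor
          · linarith
          · rw [add_mul] at hy; omega
        rwa [this]
      omega

/-- The incidence relation of the dyadic gadget: a point `(x, a)` is joined to `(j, y, i)` when
`x` and `y` lie in the same dyadic block of height `j`. -/
def dyadicRel (k p q : ℕ) (s : Fin (2 ^ k) × Fin p) (t : Fin (k + 1) × Fin (2 ^ k) × Fin q) :
    Prop :=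
  (s.1 : ℕ) / 2 ^ (t.1 : ℕ) = (t.2.1 : ℕ) / 2 ^ (t.1 : ℕ)

open Classical in
theorem card_existsUnique_dyadicRel_le (k p q : ℕ) (A : Finset (Fin (2 ^ k) × Fin p)) :
    (univ.filter fun t => ∃! s, s ∈ A ∧ dyadicRel k p q s t).card ≤ q * 2 ^ (k + 1) := by
  have hmain := sum_card_existsUnique_dyadic_le (A : Set (Fin (2 ^ k) × Fin p))
    (fun s => (s.1 : ℕ)) k 0
  let T : Finset (Σ _ : ℕ, ℕ) := (range (k + 1)).sigma fun j =>
    (Ico (0 * 2 ^ k) ((0 + 1) * 2 ^ k)).filter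
      fun y => ∃! s, s ∈ (A : Set (Fin (2 ^ k) × Fin p)) ∧ (s.1 : ℕ) / 2 ^ j = y / 2 ^ j
  have hT : T.card ≤ 2 ^ (k + 1) := by
    rw [card_sigma]; exact hmain
  have : (univ.filter fun t => ∃! s, s ∈ A ∧ dyadicRel k p q s t).card ≤
      (T ×ˢ (univ : Finset (Fin q))).card := by
    refine card_le_card_of_injOn (fun t => (⟨(t.1 : ℕ), (t.2.1 : ℕ)⟩, t.2.2)) ?_ ?_
    · rintro ⟨j, y, i⟩ ht
      replace ht := (mem_filter.1 (mem_coe.1 ht)).2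
      simp only [coe_product, Set.mem_prod, T, mem_coe, mem_sigma, mem_range, mem_filter, mem_Ico,
        mem_univ, and_true]
      refine ⟨j.2, ⟨by simp, by simp⟩, ht⟩
    · rintro ⟨j, y, i⟩ - ⟨j', y', i'⟩ - h
      simp only [Prod.mk.injEq, Sigma.mk.injEq, heq_eq_eq] at h
      ext <;> simp [h]
  refine this.trans ?_
  rw [card_product, card_univ, Fintype.card_fin, mul_comm]
  exact Nat.mul_le_mul_left q hT

open Classical in
-- All neighbours of a single point are unique neighbours of its singleton, so the same bound
-- controls the degree.
theorem card_dyadicRel_right_le (k p q : ℕ) (s : Fin (2 ^ k) × Fin p) :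
    (univ.filter fun t => dyadicRel k p q s t).card ≤ q * 2 ^ (k + 1) := by
  refine le_of_eq_of_le ?_ (card_existsUnique_dyadicRel_le k p q {s})
  congr 1
  ext t
  simp only [mem_filter, mem_univ, true_and, mem_singleton]
  constructor
  · intro h
    exact ⟨s, ⟨rfl, h⟩, fun u hu => hu.1⟩
  · rintro ⟨u, ⟨rfl, h⟩, -⟩
    exact h

open Classical in
-- Each leaf `x` occurring in `A` sees its own `(k+1)q` vertices `(j, x, i)`, disjoint for different
-- leaves, and at most `p` elements of `A` share a leaf.
theorem mul_card_le_card_dyadicRel_nbhd (k p q : ℕ) (A : Finset (Fin (2 ^ k) × Fin p)) :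
    (k + 1) * q * A.card ≤ p * (univ.filter fun t => ∃ s ∈ A, dyadicRel k p q s t).card := by
  have h1 : A.card ≤ (A.image Prod.fst).card * p := by
    have := card_le_card (show A ⊆ (A.image Prod.fst) ×ˢ (univ : Finset (Fin p)) from fun s hs =>
      mem_product.2 ⟨mem_image_of_mem _ hs, mem_univ _⟩)
    simpa using this
  have h2 : (k + 1) * q * (A.image Prod.fst).card ≤
      (univ.filter fun t => ∃ s ∈ A, dyadicRel k p q s t).card := by
    have := card_le_card (show (univ : Finset (Fin (k + 1))) ×ˢ ((A.image Prod.fst) ×ˢ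
        (univ : Finset (Fin q))) ⊆ (univ.filter fun t => ∃ s ∈ A, dyadicRel k p q s t) from by
      rintro ⟨j, y, i⟩ ht
      simp only [mem_product, mem_image, mem_univ, true_and, and_true] at ht
      obtain ⟨s, hs, rfl⟩ := ht
      simp only [mem_filter, mem_univ, true_and]
      exact ⟨s, hs, rfl⟩)
    rw [card_product, card_product, card_univ, card_univ, Fintype.card_fin, Fintype.card_fin] at this
    refine le_of_eq_of_le ?_ this
    ring
  calc (k + 1) * q * A.card ≤ (k + 1) * q * ((A.image Prod.fst).card * p) := by gcongr
    _ = p * ((k + 1) * q * (A.image Prod.fst).card) := by ring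
    _ ≤ _ := by gcongr

end DyadicGadget

/-! ### Choice of parameters -/

/-- The parameters of the dyadic gadget. -/
theorem exists_dyadic_parameters {Δ β : ℝ} (h1 : 1 ≤ Δ * β) (h2 : 64 * β ≤ Δ) (h3 : 4 ≤ Δ) :
    ∃ k p q : ℕ, 0 < p ∧ 2 * β * p ≤ (k + 1) * q ∧ (q : ℝ) * 2 ^ (k + 1) ≤ Δ ∧
      2 * ((p : ℝ) * 2 ^ k) ≤ Δ ∧
      2 * (q : ℝ) * Real.logb 2 (2 * min (Δ / β) (Δ * β)) ≤ 24 * β * p := by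
  have hβ : 0 < β := by
    by_contra! h
    nlinarith
  set M := min (Δ / β) (Δ * β) with hM
  have hM1 : 1 ≤ M := le_min (by rw [le_div_iff₀ hβ]; linarith) h1
  have hMl : M * β ≤ Δ := by
    rw [← le_div_iff₀ hβ]; exact min_le_left _ _
  have hMr : M ≤ Δ * β := min_le_right _ _
  -- Base `4` makes `2^k` at most `√M`, which keeps the degrees, exponential in `k`, below `Δ`.
  obtain ⟨k, hk1, hk2⟩ := exists_nat_pow_near hM1 (by norm_num : (1 : ℝ) < 4)
  have hfour : (4 : ℝ) ^ k = 2 ^ k * 2 ^ k := by rw [← mul_pow]; norm_num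
  have hkpos : (0 : ℝ) < 2 ^ k := by positivity
  have hk2pow : (k : ℝ) + 1 ≤ 2 ^ k := by
    have : k + 1 ≤ 2 ^ k := Nat.lt_two_pow_self
    exact_mod_cast this
  have hsq : (2 : ℝ) ^ k * 2 ^ k ≤ Δ := by
    rw [← hfour]
    have hMM : M * M ≤ Δ * Δ := by nlinarith
    have : M ≤ Δ := by nlinarith
    linarith
  have htwo : 2 * (2 : ℝ) ^ k ≤ Δ := by
    by_contra! h
    nlinarith
  have hlog : Real.logb 2 (2 * M) ≤ 3 * (k + 1) := by
    have : Real.logb 2 (2 * M) ≤ Real.logb 2 (2 ^ (2 * k + 3)) := by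
      apply Real.logb_le_logb_of_le (by norm_num) (by positivity)
      have : (2 : ℝ) ^ (2 * k + 3) = 2 * 4 ^ (k + 1) := by
        rw [pow_add, pow_mul, pow_succ]; norm_num; ring
      linarith
    rw [Real.logb_pow, Real.logb_self_eq_one (by norm_num)] at this
    push_cast at this
    have hk0 : (0 : ℝ) ≤ k := k.cast_nonneg
    linarith
  have hlog0 : 0 ≤ Real.logb 2 (2 * M) := Real.logb_nonneg (by norm_num) (by linarith)
  have hk0 : (0 : ℝ) < k + 1 := by positivity
  -- The ratio `(k+1)q/p` should be about `2β`: copy the neighbours (`p = 1`) when `2β` is at least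
  -- `k+1`, and the points (`q = 1`) otherwise. As the rounded quotient is at least `1`, rounding
  -- loses at most a factor `2`.
  by_cases hcase : (k : ℝ) + 1 ≤ 2 * β
  · have hge : 1 ≤ 2 * β / (k + 1) := by rwa [le_div_iff₀ hk0, one_mul]
    have hq1 : 2 * β / (k + 1) ≤ (⌈2 * β / (k + 1)⌉₊ : ℝ) := Nat.le_ceil _
    have hq2 : (⌈2 * β / (k + 1)⌉₊ : ℝ) < 2 * β / (k + 1) + 1 := Nat.ceil_lt_add_one (by linarith)
    set q := ⌈2 * β / (k + 1)⌉₊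
    have hq3 : (q : ℝ) * (k + 1) ≤ 4 * β := by
      have : (q : ℝ) ≤ 4 * β / (k + 1) := by
        have : 4 * β / (k + 1) = 2 * β / (k + 1) + 2 * β / (k + 1) := by ring
        linarith
      rwa [le_div_iff₀ hk0] at this
    refine ⟨k, 1, q, one_pos, ?_, ?_, by simpa using htwo, ?_⟩
    · rw [div_le_iff₀ hk0] at hq1
      push_cast; linarith
    · have hq4 : (q : ℝ) ≤ 4 * β := by
        have : (0 : ℝ) ≤ q * k := by positivity
        linarith
      -- Geometric mean of `64β ≤ Δ` and `4^k β ≤ Δ`.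
      have h8 : 8 * β * 2 ^ k ≤ Δ := by
        have ha : (2 ^ k * 2 ^ k) * β ≤ Δ := by
          rw [← hfour]; nlinarith
        have hb : (8 * β * 2 ^ k) * (8 * β * 2 ^ k) ≤ Δ * Δ := by
          calc (8 * β * 2 ^ k) * (8 * β * 2 ^ k) = (64 * β) * ((2 ^ k * 2 ^ k) * β) := by ring
            _ ≤ Δ * Δ := by gcongr
        exact abs_le_of_sq_le_sq' (by nlinarith) (by linarith) |>.2
      rw [pow_succ]
      nlinarith
    · push_cast
      have : (q : ℝ) * Real.logb 2 (2 * M) ≤ q * (3 * (k + 1)) := by gcongr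
      linarith
  · push Not at hcase
    have hge : 1 ≤ (k + 1) / (2 * β) := by rw [le_div_iff₀ (by linarith)]; linarith
    have hp1 : (⌊((k : ℝ) + 1) / (2 * β)⌋₊ : ℝ) ≤ (k + 1) / (2 * β) := Nat.floor_le (by linarith)
    have hp2 : ((k : ℝ) + 1) / (2 * β) < (⌊((k : ℝ) + 1) / (2 * β)⌋₊ : ℝ) + 1 :=
      Nat.lt_floor_add_one _
    have hp0 : 0 < ⌊((k : ℝ) + 1) / (2 * β)⌋₊ := Nat.floor_pos.2 hge
    set p := ⌊((k : ℝ) + 1) / (2 * β)⌋₊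
    have hp0' : (1 : ℝ) ≤ p := by exact_mod_cast hp0
    rw [le_div_iff₀ (by linarith)] at hp1
    rw [div_lt_iff₀ (by linarith)] at hp2
    refine ⟨k, p, 1, hp0, by push_cast; linarith, by rw [pow_succ]; push_cast; linarith, ?_, ?_⟩
    · refine le_of_mul_le_mul_right ?_ hβ
      calc 2 * ((p : ℝ) * 2 ^ k) * β = (p * (2 * β)) * 2 ^ k := by ring
        _ ≤ (k + 1) * 2 ^ k := by gcongr
        _ ≤ 2 ^ k * 2 ^ k := by gcongr
        _ ≤ Δ * β := by rw [← hfour]; linarith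
    · push_cast
      nlinarith

/-! ### Attaching the gadget to an expanding graph -/

/-- Attach to a graph `H` on `R` an independent set `S` through the relation `r`. -/
def attachGraph {S R : Type*} (r : S → R → Prop) (H : SimpleGraph R) : SimpleGraph (S ⊕ R) where
  Adj
    | .inl _, .inl _ => False
    | .inl s, .inr v => r s v
    | .inr v, .inl s => r s v
    | .inr v, .inr w => H.Adj v w
  symm := ⟨by
    rintro (s | v) (t | w) h
    · exact h
    · exact h
    · exact h
    · exact SimpleGraph.Adj.symm h⟩
  loopless := ⟨by
    rintro (s | v) h
    · exact h
    · exact H.loopless.irrefl v h⟩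

section Attach

@[simp]
theorem attachGraph_adj_inl_inl {S R : Type*} (r : S → R → Prop) (H : SimpleGraph R) (s t : S) :
    ¬ (attachGraph r H).Adj (.inl s) (.inl t) := id

@[simp]
theorem attachGraph_adj_inl_inr {S R : Type*} (r : S → R → Prop) (H : SimpleGraph R) (s : S)
    (v : R) : (attachGraph r H).Adj (.inl s) (.inr v) ↔ r s v := Iff.rfl

@[simp]
theorem attachGraph_adj_inr_inl {S R : Type*} (r : S → R → Prop) (H : SimpleGraph R) (s : S)
    (v : R) : (attachGraph r H).Adj (.inr v) (.inl s) ↔ r s v := Iff.rfl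

@[simp]
theorem attachGraph_adj_inr_inr {S R : Type*} (r : S → R → Prop) (H : SimpleGraph R) (v w : R) :
    (attachGraph r H).Adj (.inr v) (.inr w) ↔ H.Adj v w := Iff.rfl

variable {S R : Type*} [Fintype S] [Fintype R] (r : S → R → Prop) (H : SimpleGraph R)

open Classical in
theorem card_filter_attach_adj_inl (s : S) :
    (univ.filter fun x => (attachGraph r H).Adj (.inl s) x).card = (univ.filter fun v => r s v).card := by
  rw [← card_map (Function.Embedding.inr (α := S)) (s := univ.filter fun v => r s v)]
  congr 1
  ext (t | w) <;> simp

open Classical in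
theorem card_filter_attach_adj_inr (v : R) :
    (univ.filter fun x => (attachGraph r H).Adj (.inr v) x).card =
      (univ.filter fun s => r s v).card + (univ.filter fun w => H.Adj v w).card := by
  rw [← card_disjSum]
  congr 1
  ext (t | w) <;> simp

open Classical in
theorem card_uniqueNbhd_attach (A : Finset S) :
    (uniqueNbhd (attachGraph r H) (univ.map .inl) (A.map .inl)).card =
      (univ.filter fun v => ∃! s, s ∈ A ∧ r s v).card := by
  rw [← card_map (Function.Embedding.inr (α := S)) (s := univ.filter fun v => ∃! s, s ∈ A ∧ r s v)]
  congr 1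
  ext (t | w)
  · simp [uniqueNbhd]
  · simp only [uniqueNbhd, mem_filter, mem_univ, true_and, mem_map]
    constructor
    · rintro ⟨-, x, ⟨⟨s, hs, rfl⟩, hsw⟩, hu⟩
      refine ⟨w, ⟨s, ⟨hs, hsw⟩, fun t ht => ?_⟩, rfl⟩
      exact Sum.inl_injective (hu (.inl t) ⟨⟨t, ht.1, rfl⟩, ht.2⟩)
    · rintro ⟨w', ⟨s, ⟨hs, hsw⟩, hu⟩, he⟩
      obtain rfl : w' = w := Sum.inr_injective he
      refine ⟨by simp, .inl s, ⟨⟨s, hs, rfl⟩, hsw⟩, ?_⟩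
      rintro y ⟨⟨t, ht, rfl⟩, htw⟩
      exact congrArg Sum.inl (hu t ⟨ht, htw⟩)

open Classical in
theorem mul_card_le_extNbhd_attach {β K : ℝ}
    (hr : ∀ A : Finset S, 2 * β * (A.card : ℝ) ≤ ((univ.filter fun v => ∃ s ∈ A, r s v).card : ℝ))
    (hH : ∀ B : Finset R, (B.card : ℝ) ≤ K →
      (2 * β + 1) * (B.card : ℝ) ≤ ((extNbhd H B).card : ℝ))
    (X : Finset (S ⊕ R)) (hX : (X.card : ℝ) ≤ K) :
    β * (X.card : ℝ) ≤ ((extNbhd (attachGraph r H) X).card : ℝ) := by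
  set A := X.toLeft
  set B := X.toRight
  have hcard : (X.card : ℝ) = A.card + B.card := by
    have := X.card_toLeft_add_card_toRight
    exact_mod_cast this.symm
  have h1 : ((extNbhd H B).card : ℝ) ≤ ((extNbhd (attachGraph r H) X).card : ℝ) := by
    have : (extNbhd H B).card ≤ (extNbhd (attachGraph r H) X).card := by
      rw [← card_map (Function.Embedding.inr (α := S))]
      refine card_le_card fun x hx => ?_
      obtain ⟨v, hv, rfl⟩ := mem_map.1 hx
      simp only [extNbhd, mem_filter, mem_univ, true_and, B, mem_toRight] at hv ⊢
      obtain ⟨hvX, u, hu, huv⟩ := hv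
      exact ⟨hvX, .inr u, hu, huv⟩
    exact_mod_cast this
  have h2 : ((univ.filter fun v => ∃ s ∈ A, r s v).card : ℝ) ≤
      ((extNbhd (attachGraph r H) X).card : ℝ) + B.card := by
    have : (univ.filter fun v => ∃ s ∈ A, r s v).card ≤
        (extNbhd (attachGraph r H) X).card + B.card := by
      rw [← card_map (Function.Embedding.inr (α := S)),
        ← card_map (Function.Embedding.inr (α := S)) (s := B)]
      refine (card_le_card fun x hx => ?_).trans (card_union_le _ _)
      obtain ⟨v, hv, rfl⟩ := mem_map.1 hx
      simp only [mem_filter, mem_univ, true_and, A, mem_toLeft] at hv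
      obtain ⟨s, hs, hsv⟩ := hv
      rw [mem_union]
      by_cases hvX : Sum.inr v ∈ X
      · exact Or.inr (mem_map.2 ⟨v, mem_toRight.2 hvX, rfl⟩)
      · refine Or.inl ?_
        simp only [extNbhd, mem_filter, mem_univ, true_and]
        exact ⟨hvX, .inl s, hs, hsv⟩
    exact_mod_cast this
  have hA := hr A
  have hA0 : (0 : ℝ) ≤ A.card := by positivity
  have hB := hH B (by linarith)
  rw [hcard]
  -- If `B` dominates, `(2β+1)|B| ≥ β(|A|+|B|)`. If `A` dominates, its neighbours outside `B` number
  -- at least `2β|A| - |B| ≥ β(|A|+|B|)`.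
  by_cases hc : β * (A.card : ℝ) ≤ (β + 1) * B.card
  · nlinarith
  · nlinarith

end Attach

/-! ### Raising the maximum degree to exactly `Δ` -/

section Degree

variable {V : Type*} [Fintype V]

open Classical in
theorem card_extNbhd_mono {G G' : SimpleGraph V} (h : G ≤ G') (S : Finset V) :
    (extNbhd G S).card ≤ (extNbhd G' S).card := by
  refine card_le_card fun v hv => ?_
  simp only [extNbhd, mem_filter, mem_univ, true_and] at hv ⊢
  obtain ⟨hvS, u, hu, huv⟩ := hv
  exact ⟨hvS, u, hu, h huv⟩

theorem IsExpander.mono {G G' : SimpleGraph V} {α β : ℝ} (hG : IsExpander G α β) (h : G ≤ G') :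
    IsExpander G' α β :=
  ⟨hG.1, hG.2.1, fun S hS => (hG.2.2 S hS).trans (by exact_mod_cast card_extNbhd_mono h S)⟩

open Classical in
/-- A graph of maximum degree at most `Δ` can be completed to one of maximum degree exactly `Δ`
without changing the edges at a given set of vertices. -/
theorem exists_ge_maxDegree_eq (G : SimpleGraph V) (T : Finset V) (Δ : ℕ)
    (hG : ∀ v, G.degree v ≤ Δ) (hT : T.card + Δ + 1 ≤ Fintype.card V) :
    ∃ G' : SimpleGraph V, G ≤ G' ∧ G'.maxDegree = Δ ∧
      ∀ u ∈ T, ∀ v, G'.Adj u v ↔ G.Adj u v := by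
  let P : Finset (SimpleGraph V) := univ.filter fun G' =>
    G ≤ G' ∧ (∀ v, G'.degree v ≤ Δ) ∧ ∀ u ∈ T, ∀ v, G'.Adj u v ↔ G.Adj u v
  have hP : P.Nonempty := ⟨G, by simpa [P] using hG⟩
  -- In an edge-maximal admissible graph with all degrees below `Δ`, two nonadjacent vertices
  -- outside `T` could still be joined.
  obtain ⟨G', hG'⟩ := P.exists_maximal hP
  have hmem := hG'.1
  simp only [P, mem_filter, mem_univ, true_and] at hmem
  obtain ⟨hle, hdeg, hagree⟩ := hmem
  refine ⟨G', hle, ?_, hagree⟩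
  refine le_antisymm (G'.maxDegree_le_of_forall_degree_le _ hdeg) ?_
  by_contra! hlt
  have hdeg' : ∀ v, G'.degree v < Δ := fun v => (G'.degree_le_maxDegree v).trans_lt hlt
  obtain ⟨a, -, ha⟩ : ∃ a ∈ (univ : Finset V), a ∉ T :=
    exists_mem_notMem_of_card_lt_card (by rw [card_univ]; omega)
  obtain ⟨b, -, hb⟩ : ∃ b ∈ (univ : Finset V), b ∉ T ∪ insert a (G'.neighborFinset a) := by
    refine exists_mem_notMem_of_card_lt_card ?_
    have h1 := card_union_le T (insert a (G'.neighborFinset a))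
    have h2 := card_insert_le a (G'.neighborFinset a)
    have h3 := hdeg' a
    rw [← G'.card_neighborFinset_eq_degree] at h3
    rw [card_univ]; omega
  simp only [mem_union, mem_insert, SimpleGraph.mem_neighborFinset, not_or] at hb
  obtain ⟨hbT, hba, hab⟩ := hb
  obtain ⟨G'', hdef⟩ : ∃ G'', G'' = G' ⊔ SimpleGraph.edge a b := ⟨_, rfl⟩
  have hle' : G' ≤ G'' := hdef ▸ le_sup_left
  have hadj : ∀ u v, G''.Adj u v ↔ G'.Adj u v ∨ ((u = a ∧ v = b) ∨ (u = b ∧ v = a)) := by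
    intro u v
    simp only [hdef, SimpleGraph.sup_adj, SimpleGraph.edge_adj]
    constructor
    · rintro (h | h)
      · exact Or.inl h
      · right; tauto
    · rintro (h | ⟨rfl, rfl⟩ | ⟨rfl, rfl⟩)
      · exact Or.inl h
      · right; tauto
      · right; tauto
  have hmem'' : G'' ∈ P := by
    simp only [P, mem_filter, mem_univ, true_and]
    refine ⟨hle.trans hle', fun v => ?_, fun u hu v => ?_⟩
    · have hsub : G''.neighborFinset v ⊆ insert (if v = a then b else a) (G'.neighborFinset v) := by
        intro w hw
        rw [SimpleGraph.mem_neighborFinset, hadj] at hw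
        rw [mem_insert, SimpleGraph.mem_neighborFinset]
        rcases hw with h | ⟨rfl, rfl⟩ | ⟨rfl, rfl⟩
        · exact Or.inr h
        · simp
        · left; rw [if_neg hba]
      have h1 := (card_le_card hsub).trans (card_insert_le _ _)
      rw [SimpleGraph.card_neighborFinset_eq_degree, SimpleGraph.card_neighborFinset_eq_degree] at h1
      have := hdeg' v
      omega
    · rw [hadj, ← hagree u hu v]
      constructor
      · rintro (h | ⟨rfl, -⟩ | ⟨rfl, -⟩)
        · exact h
        · exact absurd hu ha
        · exact absurd hu hbT
      · exact Or.inl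
  exact hab (hG'.2 hmem'' hle' ((hadj a b).2 (Or.inr (Or.inl ⟨rfl, rfl⟩))))

end Degree

/-! ### Transport along bijections and upper bounds on wireless expansion -/

section Transport

variable {V W : Type*} [Fintype V] [Fintype W]

theorem card_extNbhd_comap (e : W ≃ V) (G : SimpleGraph V) (S : Finset W) :
    (extNbhd (G.comap e) S).card = (extNbhd G (S.map e.toEmbedding)).card := by
  classical
  rw [← card_map e.toEmbedding]
  congr 1
  ext v
  obtain ⟨w, rfl⟩ := e.surjective v
  have : (∃ u ∈ S, G.Adj (e u) (e w)) ↔ ∃ u ∈ S.map e.toEmbedding, G.Adj u (e w) := by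
    simpa using e.exists_congr_right (q := fun u => e.symm u ∈ S ∧ G.Adj u (e w))
  simp only [extNbhd, mem_filter, mem_univ, true_and, SimpleGraph.comap_adj, ← this]
  simp

theorem card_uniqueNbhd_comap (e : W ≃ V) (G : SimpleGraph V) (S S' : Finset W) :
    (uniqueNbhd (G.comap e) S S').card =
      (uniqueNbhd G (S.map e.toEmbedding) (S'.map e.toEmbedding)).card := by
  classical
  rw [← card_map e.toEmbedding]
  congr 1
  ext v
  obtain ⟨w, rfl⟩ := e.surjective v
  have : (∃! u, u ∈ S' ∧ G.Adj (e u) (e w)) ↔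
      ∃! u, u ∈ S'.map e.toEmbedding ∧ G.Adj u (e w) := by
    rw [← e.existsUnique_congr_right (q := fun u => u ∈ S'.map e.toEmbedding ∧ G.Adj u (e w))]
    simp
  simp only [uniqueNbhd, mem_filter, mem_univ, true_and, SimpleGraph.comap_adj, ← this]
  simp

theorem IsExpander.comap (e : W ≃ V) {G : SimpleGraph V} {α β : ℝ} (hG : IsExpander G α β) :
    IsExpander (G.comap e) α β := by
  refine ⟨hG.1, hG.2.1, fun S hS => ?_⟩
  rw [card_extNbhd_comap]
  have := hG.2.2 (S.map e.toEmbedding) (by rwa [card_map, ← Fintype.card_congr e])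
  rwa [card_map] at this

theorem maxDegree_comap_equiv (e : W ≃ V) (G : SimpleGraph V) [DecidableRel G.Adj]
    [DecidableRel (G.comap e).Adj] : (G.comap e).maxDegree = G.maxDegree := by
  have hdeg : ∀ w, (G.comap e).degree w = G.degree (e w) := fun w =>
    ((SimpleGraph.Iso.comap e G).degree_eq w).symm
  refine le_antisymm (SimpleGraph.maxDegree_le_of_forall_degree_le _ _ fun w => ?_)
    (SimpleGraph.maxDegree_le_of_forall_degree_le _ _ fun v => ?_)
  · rw [hdeg]
    exact G.degree_le_maxDegree _
  · obtain ⟨w, rfl⟩ := e.surjective v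
    rw [← hdeg]
    exact SimpleGraph.degree_le_maxDegree _ _

theorem wirelessExpansion_le (G : SimpleGraph V) {α b : ℝ} {S : Finset V} (hS : S.Nonempty)
    (hSα : (S.card : ℝ) ≤ α * Fintype.card V)
    (h : ∀ S' ⊆ S, ((uniqueNbhd G S S').card : ℝ) ≤ b * S.card) :
    wirelessExpansion G α ≤ b := by
  have hpos : (0 : ℝ) < S.card := by exact_mod_cast hS.card_pos
  -- `sInf` on the reals is a lower bound only for sets bounded below; here the subset `S' = ∅`
  -- already gives a nonnegative ratio.
  have hbdd : BddBelow {r : ℝ | ∃ S : Finset V, S.Nonempty ∧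
      (S.card : ℝ) ≤ α * Fintype.card V ∧ r = setWirelessExpansion G S} := by
    refine ⟨0, ?_⟩
    rintro _ ⟨S, -, -, rfl⟩
    exact le_trans (by positivity) (Finset.le_sup' (fun S' => ((uniqueNbhd G S S').card : ℝ) /
      (S.card : ℝ)) (Finset.empty_mem_powerset S))
  refine (csInf_le hbdd ⟨S, hS, hSα, rfl⟩).trans ?_
  refine Finset.sup'_le _ _ fun S' hS' => ?_
  rw [div_le_iff₀ hpos]
  exact h S' (mem_powerset.1 hS')

end Transport

theorem uniqueNbhd_congr {V : Type*} [Fintype V] {G G' : SimpleGraph V} {S S' : Finset V}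
    (h : ∀ u ∈ S, ∀ v, G'.Adj u v ↔ G.Adj u v) (hS : S' ⊆ S) :
    uniqueNbhd G' S S' = uniqueNbhd G S S' := by
  ext v
  simp only [uniqueNbhd, mem_filter, mem_univ, true_and]
  refine and_congr_right fun _ => existsUnique_congr fun u => and_congr_right fun hu => ?_
  exact h u (hS hu) v

/-! ### Embedding the gadget's neighbour side -/

section Pushforward

variable {S N R : Type*} [Fintype N] [Fintype R] (ρ : S → N → Prop) (e : N ↪ R)

/-- The relation `ρ` transported along the embedding `e` of its codomain. -/
def pushRel (s : S) (v : R) : Prop := ∃ t, e t = v ∧ ρ s t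

/-- Vertices outside the range of `e` are related to nothing, so `hQ` excludes them. The generality
in `Q` covers neighbourhoods, degrees and unique neighbourhoods at once. -/
theorem card_filter_pushRel (Q : (S → Prop) → Prop) (hQ : ¬ Q fun _ => False)
    [DecidablePred fun v => Q fun s => pushRel ρ e s v] [DecidablePred fun t => Q fun s => ρ s t] :
    (univ.filter fun v => Q fun s => pushRel ρ e s v).card =
      (univ.filter fun t => Q fun s => ρ s t).card := by
  have hpush : ∀ s t, pushRel ρ e s (e t) ↔ ρ s t := fun s t =>
    ⟨fun ⟨t', ht', h⟩ => e.injective ht' ▸ h, fun h => ⟨t, rfl, h⟩⟩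
  rw [← card_map e]
  congr 1
  ext v
  simp only [mem_filter, mem_univ, true_and, mem_map]
  constructor
  · intro h
    by_cases hv : ∃ t, e t = v
    · obtain ⟨t, rfl⟩ := hv
      exact ⟨t, by simpa only [hpush] using h, rfl⟩
    · refine absurd ?_ hQ
      convert h using 2 with s
      simp only [false_iff]
      rintro ⟨t, ht, -⟩
      exact hv ⟨t, ht⟩
  · rintro ⟨t, ht, rfl⟩
    simpa only [hpush] using ht

end Pushforward

/-! ### Assembly for `β` small compared with `Δ` -/

open Classical in
/-- Assembling a gadget, an expanding graph and additional edges. -/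
theorem exists_expander_of_gadget {S N : Type*} [Fintype S] [Fintype N] [Nonempty S]
    (ρ : S → N → Prop) {Δ : ℕ} {α β b : ℝ} (hα : 0 < α) (hβ : 0 < β)
    (hαβ : α ≤ 1 / 10000 / (1 + β)) (hΔ : 64 + 32 * β ≤ Δ)
    (hexp : ∀ A : Finset S,
      2 * β * (A.card : ℝ) ≤ ((univ.filter fun t => ∃ s ∈ A, ρ s t).card : ℝ))
    (hdegS : ∀ s, (univ.filter fun t => ρ s t).card ≤ Δ)
    (hdegN : 2 * Fintype.card S ≤ Δ)
    (huniq : ∀ A : Finset S,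
      ((univ.filter fun t => ∃! s, s ∈ A ∧ ρ s t).card : ℝ) ≤ b * Fintype.card S)
    {n : ℕ} (hn : (Fintype.card S : ℝ) ≤ α * n)
    (hnN : 2 * Fintype.card S + Fintype.card N + Δ + 1 ≤ n) :
    ∃ (G : SimpleGraph (Fin n)) (_ : DecidableRel G.Adj),
      G.maxDegree = Δ ∧ IsExpander G α β ∧ wirelessExpansion G α ≤ b := by
  set m := n - Fintype.card S with hm
  obtain ⟨e⟩ : Nonempty (N ↪ Fin m) :=
    Function.Embedding.nonempty_of_card_le (by rw [Fintype.card_fin]; omega)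
  set h := ⌈2 * β + 1⌉₊ with hh
  have hh1 : 2 * β + 1 ≤ (h : ℝ) := Nat.le_ceil _
  have hh2 : (h : ℝ) < 2 * β + 1 + 1 := Nat.ceil_lt_add_one (by linarith)
  obtain ⟨H, hHdeg, hHexp⟩ := exists_expanding_graph (Fin m) h
  have hcardV : Fintype.card (S ⊕ Fin m) = n := by
    rw [Fintype.card_sum, Fintype.card_fin]; omega
  let G₀ := attachGraph (pushRel ρ e) H
  let T : Finset (S ⊕ Fin m) := univ.map .inl
  have hTcard : T.card = Fintype.card S := by simp [T]
  have hmn : (n : ℝ) ≤ 2 * m := by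
    have : n ≤ 2 * m := by omega
    exact_mod_cast this
  have hG₀exp : IsExpander G₀ α β := by
    refine ⟨hα, hβ, fun X hX => ?_⟩
    refine mul_card_le_extNbhd_attach _ _ (K := α * Fintype.card (S ⊕ Fin m)) (fun A => ?_)
      (fun B hB => ?_) X hX
    · have hc : (univ.filter fun v => ∃ s ∈ A, pushRel ρ e s v).card =
          (univ.filter fun t => ∃ s ∈ A, ρ s t).card :=
        card_filter_pushRel ρ e (fun P => ∃ s ∈ A, P s) (by simp)
      rw [hc]
      exact hexp A
    · rw [hcardV] at hB
      have hn0 : (0 : ℝ) ≤ n := n.cast_nonneg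
      have h1 : (B.card : ℝ) * (1 + β) ≤ 1 / 10000 * n := by
        rw [le_div_iff₀ (by linarith)] at hαβ
        nlinarith
      have hB0 : (0 : ℝ) ≤ B.card := by positivity
      -- Here `h + 1 < 3(1 + β)` and `n ≤ 2m`, so the left side is at most `72/10000 * n`, well
      -- below `m`.
      have h2 : (24 : ℝ) * ((h + 1) * B.card) ≤ m := by nlinarith
      have h3 := hHexp B (by rw [Fintype.card_fin]; exact_mod_cast h2)
      have h4 : (h : ℝ) * B.card ≤ (extNbhd H B).card := by exact_mod_cast h3
      nlinarith
  have hG₀deg : ∀ x, G₀.degree x ≤ Δ := by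
    intro x
    rw [← SimpleGraph.card_neighborFinset_eq_degree, SimpleGraph.neighborFinset_eq_filter]
    rcases x with s | v
    · rw [card_filter_attach_adj_inl]
      have hc : (univ.filter fun v => pushRel ρ e s v).card = (univ.filter fun t => ρ s t).card :=
        card_filter_pushRel ρ e (fun P => P s) (by simp)
      exact hc.trans_le (hdegS s)
    · rw [card_filter_attach_adj_inr]
      have h1 := hHdeg v
      have h2 : (univ.filter fun s => pushRel ρ e s v).card ≤ Fintype.card S := card_le_univ _
      -- The degree budget is split: `H` uses at most half of `Δ`, the attached points the other
      -- half.
      have h3 : 8 * (h + 2) ≤ Δ := by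
        have : (8 : ℝ) * (h + 2) ≤ Δ := by linarith
        exact_mod_cast this
      omega
  obtain ⟨G, hle, hmax, hagree⟩ := exists_ge_maxDegree_eq G₀ T Δ hG₀deg (by omega)
  have hcardFin : Fintype.card (Fin n) = Fintype.card (S ⊕ Fin m) := by
    rw [hcardV, Fintype.card_fin]
  let f : Fin n ≃ S ⊕ Fin m := Fintype.equivOfCardEq hcardFin
  refine ⟨G.comap f, inferInstance, ?_, (hG₀exp.mono hle).comap f, ?_⟩
  · rw [← hmax]
    classical exact maxDegree_comap_equiv f G
  · refine wirelessExpansion_le _ (S := T.map f.symm.toEmbedding) ?_ ?_ ?_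
    · simp [T]
    · rw [card_map, hTcard, Fintype.card_fin]; exact hn
    · intro S' hS'
      have hTf : (T.map f.symm.toEmbedding).map f.toEmbedding = T := by
        ext x; simp
      have hS'T : S'.map f.toEmbedding ⊆ T := by
        rw [← hTf]; exact map_subset_map.2 hS'
      obtain ⟨A, hA⟩ : ∃ A : Finset S, S'.map f.toEmbedding = A.map .inl := by
        obtain ⟨A, -, hA⟩ := subset_map_iff.1 hS'T
        exact ⟨A, hA⟩
      have hc : (univ.filter fun v => ∃! s, s ∈ A ∧ pushRel ρ e s v).card =
          (univ.filter fun t => ∃! s, s ∈ A ∧ ρ s t).card :=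
        card_filter_pushRel ρ e (fun P => ∃! s, s ∈ A ∧ P s) (by simp)
      rw [card_uniqueNbhd_comap, hTf, uniqueNbhd_congr hagree hS'T, hA, card_uniqueNbhd_attach, hc,
        card_map, hTcard]
      exact huniq A

theorem exists_expander_wirelessExpansion_le {Δ : ℕ} {α β : ℝ} (hΔ : 1 ≤ Δ)
    (hβ₁ : 1 / (Δ : ℝ) ≤ β) (hβ₂ : β ≤ 1 / 10000 * Δ) (hα : 0 < α)
    (hαβ : α ≤ 1 / 10000 / (1 + β)) :
    ∃ n₀ : ℕ, ∀ n : ℕ, n₀ ≤ n → ∃ (G : SimpleGraph (Fin n)) (_ : DecidableRel G.Adj),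
      1 ≤ α * (n : ℝ) ∧ G.maxDegree = Δ ∧ IsExpander G α β ∧
      wirelessExpansion G α ≤
        24 * (β / Real.logb 2 (2 * min ((Δ : ℝ) / β) ((Δ : ℝ) * β))) := by
  classical
  have hΔ0 : (0 : ℝ) < Δ := by exact_mod_cast hΔ
  have hβ : 0 < β := lt_of_lt_of_le (by positivity) hβ₁
  have hΔβ : 1 ≤ Δ * β := by rwa [div_le_iff₀' hΔ0] at hβ₁
  -- The range `1/Δ ≤ β ≤ Δ/10000` is empty unless `Δ² ≥ 10000`.
  have hΔ100 : (100 : ℝ) ≤ Δ := by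
    by_contra! hlt
    nlinarith
  obtain ⟨k, p, q, hp, hexp, hdegS, hdegN, hlog⟩ :=
    exists_dyadic_parameters (Δ := Δ) (β := β) hΔβ (by linarith) (by linarith)
  have hp' : (0 : ℝ) < p := by exact_mod_cast hp
  have hM : 1 ≤ min ((Δ : ℝ) / β) (Δ * β) :=
    le_min (by rw [le_div_iff₀ hβ]; linarith) hΔβ
  have hlogpos : 0 < Real.logb 2 (2 * min ((Δ : ℝ) / β) (Δ * β)) :=
    Real.logb_pos (by norm_num) (by linarith)
  have hcardS : Fintype.card (Fin (2 ^ k) × Fin p) = 2 ^ k * p := by simp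
  have : Nonempty (Fin p) := ⟨⟨0, hp⟩⟩
  -- The first summand makes the point set an admissible test set, `|S| ≤ αn`; the rest leaves room
  -- for the gadget and for the added edges.
  refine ⟨⌈((2 ^ k * p : ℕ) : ℝ) / α⌉₊ + (2 * (2 ^ k * p) +
    Fintype.card (Fin (k + 1) × Fin (2 ^ k) × Fin q) + Δ + 1), fun n hn => ?_⟩
  have hSn : ((2 ^ k * p : ℕ) : ℝ) ≤ α * n := by
    rw [← div_le_iff₀' hα]
    refine (Nat.le_ceil _).trans ?_
    exact_mod_cast (Nat.le_add_right _ _).trans hn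
  have hS1 : (1 : ℝ) ≤ ((2 ^ k * p : ℕ) : ℝ) := by
    exact_mod_cast Nat.succ_le_of_lt (by positivity)
  suffices h : ∃ (G : SimpleGraph (Fin n)) (_ : DecidableRel G.Adj),
      G.maxDegree = Δ ∧ IsExpander G α β ∧ wirelessExpansion G α ≤
        24 * (β / Real.logb 2 (2 * min ((Δ : ℝ) / β) ((Δ : ℝ) * β))) by
    obtain ⟨G, dec, h⟩ := h
    exact ⟨G, dec, hS1.trans hSn, h⟩
  refine exists_expander_of_gadget (dyadicRel k p q) hα hβ hαβ
    (by linarith) ?_ ?_ ?_ ?_ (by rw [hcardS]; exact hSn) (by rw [hcardS]; omega)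
  · intro A
    have h1 : ((k : ℝ) + 1) * q * A.card ≤
        p * (univ.filter fun t => ∃ s ∈ A, dyadicRel k p q s t).card := by
      exact_mod_cast mul_card_le_card_dyadicRel_nbhd k p q A
    refine le_of_mul_le_mul_left ?_ hp'
    calc (p : ℝ) * (2 * β * A.card) = (2 * β * p) * A.card := by ring
      _ ≤ ((k + 1) * q) * A.card := by gcongr
      _ ≤ _ := h1
  · intro s
    refine (card_dyadicRel_right_le k p q s).trans ?_
    exact_mod_cast hdegS
  · rw [hcardS, mul_comm (2 ^ k)]
    exact_mod_cast hdegN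
  · intro A
    have h1 : ((univ.filter fun t => ∃! s, s ∈ A ∧ dyadicRel k p q s t).card : ℝ) ≤
        q * 2 ^ (k + 1) := by
      exact_mod_cast card_existsUnique_dyadicRel_le k p q A
    refine h1.trans ?_
    rw [hcardS, ← mul_div_assoc, div_mul_eq_mul_div, le_div_iff₀ hlogpos, pow_succ]
    push_cast
    calc (q : ℝ) * (2 ^ k * 2) * Real.logb 2 (2 * min ((Δ : ℝ) / β) (Δ * β))
        = 2 ^ k * (2 * q * Real.logb 2 (2 * min ((Δ : ℝ) / β) (Δ * β))) := by ring
      _ ≤ 2 ^ k * (24 * β * p) := by gcongr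
      _ = _ := by ring

/-! ### The range where `β` is comparable to `Δ` -/

/-- The complete graph on `Δ + 1` vertices, at the scale of single vertices. -/
theorem completeGraph_isExpander_and_wirelessExpansion_le {Δ : ℕ} {β : ℝ} (hβ : 0 < β)
    (hβΔ : β ≤ Δ) :
    IsExpander (⊤ : SimpleGraph (Fin (Δ + 1))) (1 / ((Δ : ℝ) + 1)) β ∧
      wirelessExpansion (⊤ : SimpleGraph (Fin (Δ + 1))) (1 / ((Δ : ℝ) + 1)) ≤ Δ := by
  classical
  have hαn : 1 / ((Δ : ℝ) + 1) * (Fintype.card (Fin (Δ + 1)) : ℝ) = 1 := by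
    rw [Fintype.card_fin]; push_cast; field_simp
  refine ⟨⟨by positivity, hβ, fun S hS => ?_⟩, ?_⟩
  · rw [hαn] at hS
    have hS1 : S.card ≤ 1 := by exact_mod_cast hS
    rcases Nat.le_one_iff_eq_zero_or_eq_one.1 hS1 with h0 | h1
    · rw [h0]; simp
    · obtain ⟨v, rfl⟩ := card_eq_one.1 h1
      have : extNbhd (⊤ : SimpleGraph (Fin (Δ + 1))) {v} = univ.erase v := by
        ext w
        simp [extNbhd, eq_comm]
      rw [this, card_erase_of_mem (mem_univ _)]
      simpa using hβΔ
  · refine wirelessExpansion_le _ (S := {0}) (singleton_nonempty _) (by rw [hαn]; simp) ?_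
    intro S' _
    have : uniqueNbhd (⊤ : SimpleGraph (Fin (Δ + 1))) {0} S' ⊆ univ.erase 0 := by
      intro w hw
      simp only [uniqueNbhd, mem_filter, mem_univ, true_and, mem_singleton] at hw
      exact mem_erase.2 ⟨hw.1, mem_univ _⟩
    have := card_le_card this
    rw [card_erase_of_mem (mem_univ _), card_univ, Fintype.card_fin] at this
    rw [card_singleton]
    push_cast
    rw [mul_one]
    exact_mod_cast this

theorem logb_two_mul_min_bounds {Δ β : ℝ} (h₁ : 1 ≤ Δ * β) (h₂ : β ≤ Δ)
    (h₃ : Δ ≤ 10000 * β) :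
    0 < Real.logb 2 (2 * min (Δ / β) (Δ * β)) ∧
      Real.logb 2 (2 * min (Δ / β) (Δ * β)) ≤ 15 := by
  have hβ : 0 < β := by
    by_contra! h
    nlinarith
  have hM : 1 ≤ min (Δ / β) (Δ * β) := le_min (by rw [le_div_iff₀ hβ]; linarith) h₁
  have hM' : min (Δ / β) (Δ * β) ≤ 10000 :=
    (min_le_left _ _).trans (by rwa [div_le_iff₀ hβ])
  refine ⟨Real.logb_pos (by norm_num) (by linarith), ?_⟩
  rw [Real.logb_le_iff_le_rpow (by norm_num) (by linarith)]
  norm_num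
  linarith

end WirelessExpander

/-! ### The main theorem -/

theorem theorem2 :
    ∃ C c : ℝ, 0 < C ∧ 0 < c ∧
      (∀ (Δ : ℕ) (β : ℝ), 1 ≤ Δ → 1 / (Δ : ℝ) ≤ β → β ≤ (Δ : ℝ) →
        ∃ (α : ℝ) (n : ℕ) (G : SimpleGraph (Fin n)) (_ : DecidableRel G.Adj),
          1 ≤ α * (n : ℝ) ∧ G.maxDegree = Δ ∧ WirelessExpander.IsExpander G α β ∧
          WirelessExpander.wirelessExpansion G α ≤
            C * (β / Real.logb 2 (2 * min ((Δ : ℝ) / β) ((Δ : ℝ) * β)))) ∧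
      (∀ (Δ : ℕ) (β : ℝ), 1 ≤ Δ → 1 / (Δ : ℝ) ≤ β → β ≤ c * (Δ : ℝ) →
        ∀ α : ℝ, 0 < α → α ≤ c / (1 + β) →
          ∃ n₀ : ℕ, ∀ n : ℕ, n₀ ≤ n →
            ∃ (G : SimpleGraph (Fin n)) (_ : DecidableRel G.Adj),
              1 ≤ α * (n : ℝ) ∧ G.maxDegree = Δ ∧ WirelessExpander.IsExpander G α β ∧
              WirelessExpander.wirelessExpansion G α ≤
                C * (β / Real.logb 2 (2 * min ((Δ : ℝ) / β) ((Δ : ℝ) * β)))) := by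
  have hpart2 : ∀ (Δ : ℕ) (β : ℝ), 1 ≤ Δ → 1 / (Δ : ℝ) ≤ β → β ≤ 1 / 10000 * (Δ : ℝ) →
      ∀ α : ℝ, 0 < α → α ≤ 1 / 10000 / (1 + β) →
        ∃ n₀ : ℕ, ∀ n : ℕ, n₀ ≤ n →
          ∃ (G : SimpleGraph (Fin n)) (_ : DecidableRel G.Adj),
            1 ≤ α * (n : ℝ) ∧ G.maxDegree = Δ ∧ WirelessExpander.IsExpander G α β ∧
            WirelessExpander.wirelessExpansion G α ≤
              150000 * (β / Real.logb 2 (2 * min ((Δ : ℝ) / β) ((Δ : ℝ) * β))) := by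
    intro Δ β hΔ hβ₁ hβ₂ α hα hαβ
    obtain ⟨n₀, h⟩ :=
      WirelessExpander.exists_expander_wirelessExpansion_le hΔ hβ₁ hβ₂ hα hαβ
    refine ⟨n₀, fun n hn => ?_⟩
    obtain ⟨G, dec, h1, hmax, hG, hw⟩ := h n hn
    refine ⟨G, dec, h1, hmax, hG, hw.trans ?_⟩
    have hΔ0 : (0 : ℝ) < Δ := by exact_mod_cast hΔ
    have hβ : 0 < β := lt_of_lt_of_le (by positivity) hβ₁
    have hM : 1 ≤ min ((Δ : ℝ) / β) (Δ * β) :=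
      le_min (by rw [le_div_iff₀ hβ]; linarith) (by rwa [div_le_iff₀' hΔ0] at hβ₁)
    have hlog : 0 ≤ Real.logb 2 (2 * min ((Δ : ℝ) / β) (Δ * β)) :=
      Real.logb_nonneg (by norm_num) (by linarith)
    gcongr
    norm_num
  -- The constant `150000 = 10000 * 15` comes from the complete graph, where `Δ < 10000β` and the
  -- logarithm is at most `15`; the gadget needs only `24`.
  refine ⟨150000, 1 / 10000, by norm_num, by norm_num, fun Δ β hΔ hβ₁ hβ₂ => ?_, hpart2⟩
  have hΔ0 : (0 : ℝ) < Δ := by exact_mod_cast hΔ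
  have hβ : 0 < β := lt_of_lt_of_le (by positivity) hβ₁
  rcases le_or_gt β (1 / 10000 * (Δ : ℝ)) with hc | hc
  · obtain ⟨n₀, h⟩ := hpart2 Δ β hΔ hβ₁ hc (1 / 10000 / (1 + β)) (by positivity) le_rfl
    exact ⟨_, n₀, h n₀ le_rfl⟩
  · obtain ⟨hexp, hw⟩ :=
      WirelessExpander.completeGraph_isExpander_and_wirelessExpansion_le hβ hβ₂
    refine ⟨1 / ((Δ : ℝ) + 1), Δ + 1, ⊤, inferInstance, ?_, ?_, hexp, hw.trans ?_⟩
    · push_cast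
      rw [one_div_mul_cancel (by positivity)]
    · have : Nonempty (Fin (Δ + 1)) := inferInstance
      have hreg := (SimpleGraph.IsRegularOfDegree.top (V := Fin (Δ + 1)))
      rw [hreg.maxDegree_eq]; simp
    · obtain ⟨hl, hu⟩ := WirelessExpander.logb_two_mul_min_bounds
        (by rwa [div_le_iff₀' hΔ0] at hβ₁) hβ₂ (by linarith : (Δ : ℝ) ≤ 10000 * β)
      rw [← mul_div_assoc, le_div_iff₀ hl]
      nlinarith
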